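/- Let $k\ge 2$. For $n\ge 1$ let $p'_k(n)$ be the number of partitions of $n$ into exactly $k$ positive parts whose greatest common divisor is $1$. Let $\mu$ be the Möbius function. For $t\ge 0$, a root of unity $\omega\in\mathbb{C}$, $m\ge 1$ and $0\le j\le m-1$ put $$J_t(n)=\sum_{d\mid n}d^t\mu(n/d),\qquad J_{(t,\omega)}(n)=\sum_{d\mid n}\omega^d d^t\mu(n/d),\qquad J_t^{j,m}(n)=\sum_{\substack{d\mid n\\ d\equiv j\ (\mathrm{mod}\ m)}}d^t\mu(n/d)$$ (the Jordan totient functions, Jordan root totient functions and Jordan modulo totient functions). Let $V_k=\bigcup_{m=1}^k\{z\in\mathbb{C}: z^m=1\}$. For $\omega\in V_k$ of order $m_\omega$ let $b_\omega=\lfloor k/m_\omega\rfloor$, let $s_{\omega,i}$ ($1\le i\le b_\omega$) be the coefficient of $(z-\omega^{-1})^{-i}$ in the partial fraction decomposition of $\dfrac{z^k}{(1-z)(1-z^2)\cdots(1-z^k)}$, and define $u_{\omega,t}\in\mathbb{C}$ ($0\le t\le b_\omega-1$) by $$\sum_{t=0}^{b_\omega-1}u_{\omega,t}X^t=\sum_{i=1}^{b_\omega}(-\omega)^i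 s_{\omega,i}\,\frac{(X+1)(X+2)\cdots(X+i-1)}{(i-1)!}.$$ Linear combinations are finite. Then: (i) On the entire domain $n\ge1$, $p'_k$ is a $\mathbb{C}$-linear combination of the Jordan root totient functions $J_{(t,\omega)}$ with $\omega\in V_k$; explicitly, for all $n\ge1$, $$p'_k(n)=\sum_{\omega\in V_k}\ \sum_{t=0}^{b_\omega-1}u_{\omega,t}\,J_{(t,\omega)}(n).$$ (ii) On the entire domain $n\ge1$, $p'_k$ is a $\mathbb{C}$-linear combination of the Jordan modulo totient functions; explicitly, for all $n\ge1$, $$p'_k(n)=\sum_{\omega\in V_k}\ \sum_{t=0}^{b_\omega-1}\ \sum_{j=0}^{m_\omega-1}u_{\omega,t}\,\omega^j\,J_t^{j,m_\omega}(n).$$ (iii) $p'_k$ is not a $\mathbb{C}$-linear combination of the Jordan totient functions $J_t$, $t\ge0$, on the entire domain $n\ge1$. (iv) If, for some integer $N\ge1$, $p'_k$ agrees for all $n\ge N$ with a $\mathbb{C}$-linear combination of the Jordan totient functions, then $k\in\{2,3\}$ and there is a rational number $q$ with $p'_k(n)=q\,J_{k-1}(n)$ for all $n\ge N$. Conversely,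 for $k\in\{2,3\}$ such an $N$ exists, and the least one is $k+1$; moreover $p'_2(n)=J_1(n)/2$ for all $n\ge3$ and $p'_3(n)=J_2(n)/12$ for all $n\ge4$. -/

import Mathlib

/-- The number of coprime partitions of `n` into `k` parts. -/
def coprimePartitions (k n : ℕ) : ℕ :=
  (Finset.univ.filter fun p : n.Partition => p.parts.card = k ∧ p.parts.gcd = 1).card

/-- The Jordan totient function `J_t`. -/
def jordan (t n : ℕ) : ℤ :=
  ∑ d ∈ n.divisors, (d : ℤ) ^ t * ArithmeticFunction.moebius (n / d)

/-- The Jordan root totient function `J_{(t,ω)}`. -/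
noncomputable def jordanRoot (t : ℕ) (ω : ℂ) (n : ℕ) : ℂ :=
  ∑ d ∈ n.divisors, ω ^ d * (d : ℂ) ^ t * (ArithmeticFunction.moebius (n / d) : ℂ)

/-- The Jordan modulo totient function `J_t^{j,m}`. -/
def jordanMod (t j m n : ℕ) : ℤ :=
  ∑ d ∈ n.divisors with d ≡ j [MOD m], (d : ℤ) ^ t * ArithmeticFunction.moebius (n / d)

/-- On the domain `n ≥ N`, the function `f` is a (finite) `ℂ`-linear combination of the
functions `F i`. -/
def IsLinCombOn {ι : Type} (F : ι → ℕ → ℂ) (N : ℕ) (f : ℕ → ℂ) : Prop :=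
  ∃ c : ι →₀ ℂ, ∀ n, N ≤ n → f n = c.sum fun i a => a * F i n

/-- The complex roots of unity of order at most `k`. -/
noncomputable def rootsUpTo (k : ℕ) : Finset ℂ :=
  (Finset.Icc 1 k).biUnion fun m => Polynomial.nthRootsFinset m (1 : ℂ)

/-- The multiplicity `⌊k / m⌋` of `ω⁻¹` as a root of `(1 - X)(1 - X²)⋯(1 - X^k)`, where `m` is the
order of `ω`. -/
noncomputable def poleOrder (k : ℕ) (ω : ℂ) : ℕ := k / orderOf ω

open Polynomial in
/-- The polynomial `(1 - X)(1 - X²)⋯(1 - X^k)`. -/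
noncomputable def partDenom (k : ℕ) : ℂ[X] := ∏ m ∈ Finset.Icc 1 k, (1 - X ^ m)

open Polynomial in
/-- The coefficient of `(z - ω⁻¹)^(-i)` in the partial fraction decomposition of
`z^k / ((1 - z)(1 - z²)⋯(1 - z^k))`, for `1 ≤ i ≤ b`, where `b` is the order of the pole `ω⁻¹`:
it is the coefficient of order `b - i` in the Taylor expansion at `ω⁻¹` of
`(z - ω⁻¹)^b z^k / ((1 - z)(1 - z²)⋯(1 - z^k))`. The factor `(z - ω⁻¹)^b` is cancelled exactly from
the denominator, and `taylor ω⁻¹ f` is `f(X + ω⁻¹)`. -/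
noncomputable def principalCoeff (k : ℕ) (ω : ℂ) (i : ℕ) : ℂ :=
  PowerSeries.coeff (poleOrder k ω - i)
    ((taylor ω⁻¹ (X ^ k : ℂ[X]) : PowerSeries ℂ) *
      (taylor ω⁻¹ (partDenom k /ₘ (X - C ω⁻¹) ^ poleOrder k ω) : PowerSeries ℂ)⁻¹)

open Polynomial in
/-- The polynomial `binom(X + i - 1, i - 1) = (X + 1)⋯(X + i - 1) / (i - 1)!`, for `i ≥ 1`. -/
noncomputable def shiftedBinom (i : ℕ) : ℂ[X] :=
  C ((Nat.factorial (i - 1) : ℂ)⁻¹) * ∏ j ∈ Finset.Ico 1 i, (X + C (j : ℂ))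

open Polynomial in
/-- The polynomial `P_ω` attached to `ω`, with `p_k(n) = ∑ ω, P_ω(n) ω^n`:
`P_ω(n) = ∑_{i=1}^{b} (-ω)^i s_i binom(n + i - 1, i - 1)`, with `s_i` the partial fraction
coefficients at `ω⁻¹`. -/
noncomputable def rootPoly (k : ℕ) (ω : ℂ) : ℂ[X] :=
  ∑ i ∈ Finset.Icc 1 (poleOrder k ω),
    C ((-ω) ^ i * principalCoeff k ω i) * shiftedBinom i

/-! Let $p_k(n)$ count all partitions of $n$ into exactly $k$ parts. Dividing out the gcd gives
$p_k(n)=\sum_{d\mid n}p'_k(d)$, so $p'_k=p_k*\mu$. The generating function of $p_k$ is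
$z^k/\prod_{m\le k}(1-z^m)$, and its partial fractions give $p_k(n)=\sum_\omega P_\omega(n)\omega^n$
(`card_exactParts_eq`). Convolving each monomial with $\mu$ gives (i); sorting divisors by their
residue modulo the order of $\omega$ gives (ii).

A combination of the $J_t$ is $P*\mu$ for a polynomial $P$. If it equals $p'_k$ from $N$ on, the
difference $p_k-P$ is the divisor sum of a function supported below $N$, hence periodic with period
$L=N!$. Then $(1-z^L)\sum p_k(n)z^n$ has eventually polynomial coefficients, so its only possible
pole is $1$. For $k\ge4$ the generating function has at least a double pole at $-1$, while $1-z^L$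
has only simple zeros: a contradiction (`not_isLinCombOn_jordan`).

For $k=2,3$, $p_k$ is a multiple of $n^{k-1}$ plus indicators of $a\mid n$ with $a\le k$.
Convolution with $\mu$ turns these into point masses at $a$, so $p'_k=qJ_{k-1}$ exactly beyond $k$.
The mass at $k$ cannot be absorbed, since a combination of the $J_t$ that vanishes eventually
vanishes on all $n\ge2$ (`polyMoebius_eq_zero`). Hence $k+1$ is least, and (iii) follows. -/

/-! ### Partitions into exactly `k` parts and their generating function -/

/-- The multisets of positive integers with `k` elements and sum `n`. -/
def exactParts (k n : ℕ) : Finset (Multiset ℕ) :=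
  (Finset.univ.filter fun p : n.Partition => p.parts.card = k).image Nat.Partition.parts

theorem mem_exactParts {k n : ℕ} {s : Multiset ℕ} :
    s ∈ exactParts k n ↔ s.card = k ∧ s.sum = n ∧ ∀ i ∈ s, 0 < i := by
  simp only [exactParts, Finset.mem_image, Finset.mem_filter, Finset.mem_univ, true_and]
  constructor
  · rintro ⟨p, hp, rfl⟩
    exact ⟨hp, p.parts_sum, fun i hi => p.parts_pos hi⟩
  · rintro ⟨h1, h2, h3⟩
    exact ⟨⟨s, fun {i} hi => h3 i hi, h2⟩, h1, rfl⟩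

theorem coprimePartitions_eq_card (k n : ℕ) :
    coprimePartitions k n = ((exactParts k n).filter fun s => s.gcd = 1).card := by
  rw [exactParts, Finset.filter_image, Finset.filter_filter, Finset.card_image_of_injective,
    coprimePartitions]
  intro p q h
  exact Nat.Partition.ext h

theorem exactParts_eq_empty {k n : ℕ} (h : n < k) : exactParts k n = ∅ := by
  rw [Finset.eq_empty_iff_forall_notMem]
  intro s hs
  obtain ⟨h1, h2, h3⟩ := mem_exactParts.1 hs
  have := Multiset.card_nsmul_le_sum (s := s) (a := 1) h3
  simp at this
  omega

theorem card_exactParts_zero (n : ℕ) : (exactParts 0 n).card = if n = 0 then 1 else 0 := by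
  split_ifs with h
  · subst h
    rw [Finset.card_eq_one]
    refine ⟨0, ?_⟩
    ext s
    rw [mem_exactParts, Finset.mem_singleton]
    constructor
    · rintro ⟨h, -⟩
      exact Multiset.card_eq_zero.1 h
    · rintro rfl
      simp
  · rw [Finset.card_eq_zero, Finset.eq_empty_iff_forall_notMem]
    intro s hs
    obtain ⟨h1, h2, -⟩ := mem_exactParts.1 hs
    rw [Multiset.card_eq_zero] at h1
    subst h1
    exact h (by simpa using h2.symm)

theorem exactParts_filter_one_mem (k n : ℕ) :
    ((exactParts (k + 1) (n + 1)).filter fun s => 1 ∈ s) =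
      (exactParts k n).image (Multiset.cons 1) := by
  ext s
  simp only [Finset.mem_filter, Finset.mem_image, mem_exactParts]
  constructor
  · rintro ⟨⟨h1, h2, h3⟩, h4⟩
    obtain ⟨t, rfl⟩ := Multiset.exists_cons_of_mem h4
    refine ⟨t, ⟨by simpa using h1, ?_, fun i hi => h3 i (Multiset.mem_cons_of_mem hi)⟩, rfl⟩
    rw [Multiset.sum_cons] at h2
    omega
  · rintro ⟨t, ⟨h1, h2, h3⟩, rfl⟩
    refine ⟨⟨by simpa using h1, ?_, ?_⟩, Multiset.mem_cons_self _ _⟩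
    · rw [Multiset.sum_cons]
      omega
    · intro i hi
      rcases Multiset.mem_cons.1 hi with rfl | hi
      · exact one_pos
      · exact h3 i hi

theorem exactParts_filter_one_notMem (k n : ℕ) :
    ((exactParts k (n + k)).filter fun s => 1 ∉ s) =
      (exactParts k n).image (Multiset.map Nat.succ) := by
  ext s
  simp only [Finset.mem_filter, Finset.mem_image, mem_exactParts]
  constructor
  · rintro ⟨⟨h1, h2, h3⟩, h4⟩
    have h5 : ∀ i ∈ s, 2 ≤ i := fun i hi => by
      have := h3 i hi
      have : i ≠ 1 := fun h => h4 (h ▸ hi)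
      omega
    have h6 : (s.map Nat.pred).map Nat.succ = s := by
      rw [Multiset.map_map]
      conv_rhs => rw [← Multiset.map_id s]
      refine Multiset.map_congr rfl fun i hi => ?_
      exact Nat.succ_pred_eq_of_pos (h3 i hi)
    refine ⟨s.map Nat.pred, ⟨by simpa using h1, ?_, ?_⟩, h6⟩
    · have h7 : (((s.map Nat.pred).map Nat.succ)).sum = (s.map Nat.pred).sum + k := by
        simp [Nat.succ_eq_add_one, Multiset.sum_map_add, h1]
      rw [h6, h2] at h7
      omega
    · intro i hi
      obtain ⟨j, hj, rfl⟩ := Multiset.mem_map.1 hi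
      have := h5 j hj
      rw [Nat.pred_eq_sub_one]
      omega
  · rintro ⟨t, ⟨h1, h2, h3⟩, rfl⟩
    refine ⟨⟨by simpa using h1, ?_, ?_⟩, ?_⟩
    · simp [Nat.succ_eq_add_one, Multiset.sum_map_add, h1, h2]
    · intro i hi
      obtain ⟨j, hj, rfl⟩ := Multiset.mem_map.1 hi
      exact Nat.succ_pos j
    · intro hi
      obtain ⟨j, hj, h⟩ := Multiset.mem_map.1 hi
      have := h3 j hj
      omega

/-- Split on whether 1 is a part: if so, delete one 1; otherwise subtract 1 from every part. The
shifted arguments avoid truncated subtraction. -/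
theorem card_exactParts_succ (k n : ℕ) :
    (exactParts (k + 1) (n + (k + 1))).card =
      (exactParts k (n + k)).card + (exactParts (k + 1) n).card := by
  rw [← Finset.card_filter_add_card_filter_not (fun s => 1 ∈ s), exactParts_filter_one_notMem,
    ← add_assoc, exactParts_filter_one_mem,
    Finset.card_image_of_injective _ (fun _ _ h => (Multiset.cons_inj_right 1).1 h),
    Finset.card_image_of_injective _ (Multiset.map_injective Nat.succ_injective)]

/-- The generating function of the number of partitions into exactly `k` parts. -/
noncomputable def partSeries (k : ℕ) : PowerSeries ℂ :=
  PowerSeries.mk fun n => ((exactParts k n).card : ℂ)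

theorem partSeries_succ (k : ℕ) :
    (1 - PowerSeries.X ^ (k + 1)) * partSeries (k + 1) = PowerSeries.X * partSeries k := by
  ext n
  rw [sub_mul, one_mul, map_sub, PowerSeries.coeff_X_pow_mul', partSeries, partSeries,
    PowerSeries.coeff_mk, PowerSeries.coeff_mk]
  split_ifs with h
  · obtain ⟨m, rfl⟩ := Nat.exists_eq_add_of_le' h
    rw [card_exactParts_succ, Nat.add_sub_cancel, ← add_assoc, PowerSeries.coeff_succ_X_mul,
      PowerSeries.coeff_mk]
    push_cast
    ring
  -- Below degree `k + 1` both sides vanish: there are too few units for the parts.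
  · rw [exactParts_eq_empty (by omega)]
    cases n with
    | zero => simp
    | succ n =>
      rw [PowerSeries.coeff_succ_X_mul, PowerSeries.coeff_mk, exactParts_eq_empty (by omega)]
      simp

theorem partDenom_succ (k : ℕ) :
    partDenom (k + 1) = partDenom k * (1 - Polynomial.X ^ (k + 1)) := by
  rw [partDenom, partDenom, Finset.prod_Icc_succ_top (by omega)]

theorem partDenom_mul_partSeries (k : ℕ) :
    (partDenom k : PowerSeries ℂ) * partSeries k = PowerSeries.X ^ k := by
  induction k with
  | zero =>
    ext n
    simp [partDenom, partSeries, card_exactParts_zero, PowerSeries.coeff_one]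
  | succ k ih =>
    rw [partDenom_succ, Polynomial.coe_mul, Polynomial.coe_sub, Polynomial.coe_one,
      Polynomial.coe_pow, Polynomial.coe_X, mul_assoc, partSeries_succ, mul_left_comm, ih, pow_succ']

/-! ### Sorting by gcd and Möbius inversion -/

/-- Scaling all parts by `e = n / d` is a bijection from the coprime partitions of `d` to the
partitions of `n` with gcd `e`. -/
theorem card_filter_div_gcd_eq (k : ℕ) {n d : ℕ} (hn : 0 < n) (hd : d ∈ n.divisors) :
    ((exactParts k n).filter fun s => n / s.gcd = d).card = coprimePartitions k d := by
  obtain ⟨⟨e, rfl⟩, -⟩ := Nat.mem_divisors.1 hd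
  have hd0 : 0 < d := Nat.pos_of_mul_pos_right hn
  have he0 : 0 < e := Nat.pos_of_mul_pos_left hn
  rw [coprimePartitions_eq_card]
  refine Eq.trans (congrArg Finset.card ?_) (Finset.card_image_of_injective _
    (Multiset.map_injective
      (fun a b h => Nat.eq_of_mul_eq_mul_left he0 h : Function.Injective (e * ·))))
  ext s
  simp only [Finset.mem_filter, Finset.mem_image, mem_exactParts]
  constructor
  · rintro ⟨⟨h1, h2, h3⟩, h4⟩
    have hg : s.gcd ∣ d * e := h2 ▸ Multiset.dvd_sum fun i hi => Multiset.gcd_dvd hi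
    have hge : s.gcd = e := by
      obtain ⟨c, hc⟩ := hg
      have hg0 : 0 < s.gcd := by
        rcases Nat.eq_zero_or_pos s.gcd with h | h
        · rw [h] at hc; omega
        · exact h
      rw [hc, Nat.mul_div_cancel_left _ hg0] at h4
      subst h4
      rw [mul_comm] at hc
      exact (Nat.eq_of_mul_eq_mul_right hd0 hc).symm
    have hdiv : ∀ i ∈ s, e ∣ i := fun i hi => hge ▸ Multiset.gcd_dvd hi
    have hmap : (s.map (· / e)).map (e * ·) = s := by
      rw [Multiset.map_map]
      conv_rhs => rw [← Multiset.map_id s]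
      exact Multiset.map_congr rfl fun i hi => Nat.mul_div_cancel' (hdiv i hi)
    refine ⟨s.map (· / e), ⟨⟨by simpa using h1, ?_, ?_⟩, ?_⟩, hmap⟩
    · have : ((s.map (· / e)).map (e * ·)).sum = e * (s.map (· / e)).sum :=
        Multiset.sum_map_mul_left.trans (by simp)
      rw [hmap, h2, mul_comm] at this
      exact (Nat.eq_of_mul_eq_mul_left he0 this).symm
    · intro i hi
      obtain ⟨j, hj, rfl⟩ := Multiset.mem_map.1 hi
      exact Nat.div_pos (Nat.le_of_dvd (h3 j hj) (hdiv j hj)) he0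
    · have := Multiset.gcd_map_mul e (s.map (· / e))
      rw [hmap, hge, normalize_eq] at this
      exact (Nat.eq_of_mul_eq_mul_left he0 (by rw [mul_one]; exact this)).symm
  · rintro ⟨t, ⟨⟨h1, h2, h3⟩, h4⟩, rfl⟩
    refine ⟨⟨by simpa using h1, ?_, ?_⟩, ?_⟩
    · exact Multiset.sum_map_mul_left.trans (by simp [h2, mul_comm])
    · intro i hi
      obtain ⟨j, hj, rfl⟩ := Multiset.mem_map.1 hi
      exact Nat.mul_pos he0 (h3 j hj)
    · have := Multiset.gcd_map_mul e t
      rw [this, h4, normalize_eq, mul_one, Nat.mul_div_cancel _ he0]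

theorem sum_divisors_coprimePartitions (k : ℕ) {n : ℕ} (hn : 0 < n) :
    ∑ d ∈ n.divisors, coprimePartitions k d = (exactParts k n).card := by
  rw [Finset.card_eq_sum_card_fiberwise (f := fun s => n / s.gcd) (t := n.divisors)]
  · exact Finset.sum_congr rfl fun d hd => (card_filter_div_gcd_eq k hn hd).symm
  · intro s hs
    obtain ⟨-, h, -⟩ := mem_exactParts.1 hs
    have hg : s.gcd ∣ n := h ▸ Multiset.dvd_sum fun i hi => Multiset.gcd_dvd hi
    exact Nat.mem_divisors.2 ⟨Nat.div_dvd_of_dvd hg, hn.ne'⟩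

/-- Möbius inversion, with the sum over divisors. -/
theorem sum_mul_moebius_of_sum_divisors {R : Type*} [CommRing R] {f g : ℕ → R}
    (h : ∀ n > 0, ∑ d ∈ n.divisors, f d = g n) {n : ℕ} (hn : 0 < n) :
    f n = ∑ d ∈ n.divisors, g d * (ArithmeticFunction.moebius (n / d) : R) := by
  rw [← ArithmeticFunction.sum_eq_iff_sum_mul_moebius_eq.1 h n hn,
    Nat.sum_divisorsAntidiagonal' (f := fun a b => (ArithmeticFunction.moebius a : R) * g b)]
  exact Finset.sum_congr rfl fun d _ => mul_comm _ _

theorem coprimePartitions_eq_sum {R : Type*} [CommRing R] (k : ℕ) {n : ℕ} (hn : 0 < n) :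
    (coprimePartitions k n : R) = ∑ d ∈ n.divisors,
      ((exactParts k d).card : R) * (ArithmeticFunction.moebius (n / d) : R) :=
  sum_mul_moebius_of_sum_divisors (f := fun n => (coprimePartitions k n : R))
    (fun n hn => by rw [← sum_divisors_coprimePartitions k hn]; push_cast; rfl) hn

/-! ### Partial fractions over a field -/

section PartialFractions

open Polynomial

variable {K ι : Type*} [Field K]

theorem mul_divByMonic_of_dvd {D q : K[X]} (hq : q.Monic) (h : q ∣ D) : q * (D /ₘ q) = D := by
  have := modByMonic_add_div D q
  rwa [(modByMonic_eq_zero_iff_dvd hq).2 h, zero_add] at this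

/-- The polynomial `N - T * Q`, with `T` the Taylor polynomial of `N / Q` of order `b` at `a`,
vanishes to order `b` at `a`. -/
theorem X_sub_C_pow_dvd_sub_sum (N Q : K[X]) (a : K) (b : ℕ) (hQ : Q.eval a ≠ 0) :
    (X - C a) ^ b ∣ N - ∑ j ∈ Finset.Icc 1 b,
      C (PowerSeries.coeff (b - j)
        ((taylor a N : PowerSeries K) * (taylor a Q : PowerSeries K)⁻¹)) *
          ((X - C a) ^ (b - j) * Q) := by
  set G := (taylor a N : PowerSeries K) * (taylor a Q : PowerSeries K)⁻¹ with hG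
  have hGQ : (taylor a N : PowerSeries K) = G * (taylor a Q : PowerSeries K) := by
    rw [hG, mul_assoc, PowerSeries.inv_mul_cancel, mul_one]
    rw [← PowerSeries.coeff_zero_eq_constantCoeff_apply, Polynomial.coeff_coe,
      taylor_coeff_zero]
    exact hQ
  have hsum : ∑ j ∈ Finset.Icc 1 b,
      C (PowerSeries.coeff (b - j) G) * ((X - C a) ^ (b - j) * Q) =
      (∑ j ∈ Finset.range b, C (PowerSeries.coeff j G) * (X - C a) ^ j) * Q := by
    rw [Finset.sum_mul]
    refine Finset.sum_bij' (fun j _ => b - j) (fun j _ => b - j) ?_ ?_ ?_ ?_ ?_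
    · intro j hj; simp only [Finset.mem_Icc, Finset.mem_range] at *; omega
    · intro j hj; simp only [Finset.mem_Icc, Finset.mem_range] at *; omega
    · intro j hj; simp only [Finset.mem_Icc] at *; omega
    · intro j hj; simp only [Finset.mem_range] at *; omega
    · intro j hj; ring
  rw [hsum, X_sub_C_pow_dvd_iff, ← taylor_apply, Polynomial.X_pow_dvd_iff]
  have htaylor : taylor a (∑ j ∈ Finset.range b, C (PowerSeries.coeff j G) * (X - C a) ^ j) =
      PowerSeries.trunc b G := by
    rw [map_sum]
    ext n
    rw [finsetSum_coeff, PowerSeries.coeff_trunc]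
    simp [taylor_mul, taylor_pow, taylor_X, taylor_C, coeff_X_pow]
  have hdvd : (PowerSeries.X : PowerSeries K) ^ b ∣ (taylor a (N -
      (∑ j ∈ Finset.range b, C (PowerSeries.coeff j G) * (X - C a) ^ j) * Q) : K[X]) := by
    rw [map_sub, taylor_mul, htaylor, Polynomial.coe_sub, Polynomial.coe_mul, hGQ, ← sub_mul]
    refine Dvd.dvd.mul_right (PowerSeries.X_pow_dvd_iff.2 fun m hm => ?_) _
    rw [map_sub, Polynomial.coeff_coe, PowerSeries.coeff_trunc, if_pos hm, sub_self]
  intro d hd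
  rw [← Polynomial.coeff_coe]
  exact PowerSeries.X_pow_dvd_iff.1 hdvd d hd

/-- The partial fraction decomposition of `N / D`, multiplied by `D`. -/
theorem eq_sum_principal_parts [DecidableEq ι] (S : Finset ι) (a : ι → K) (b : ι → ℕ)
    (ha : Set.InjOn a S) {c : K} (hc : c ≠ 0) {N D : K[X]}
    (hD : D = C c * ∏ i ∈ S, (X - C (a i)) ^ b i) (hN : N.degree < D.degree) :
    N = ∑ i ∈ S, ∑ j ∈ Finset.Icc 1 (b i),
      C (PowerSeries.coeff (b i - j) ((taylor (a i) N : PowerSeries K) *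
        (taylor (a i) (D /ₘ (X - C (a i)) ^ b i) : PowerSeries K)⁻¹)) *
          (D /ₘ (X - C (a i)) ^ j) := by
  have hD0 : D ≠ 0 := by
    rintro rfl
    simp at hN
  have hmonic : ∀ i j, ((X - C (a i)) ^ j : K[X]).Monic := fun i j => (monic_X_sub_C _).pow j
  have hdvd : ∀ i ∈ S, (X - C (a i)) ^ b i ∣ D := fun i hi =>
    hD ▸ (Finset.dvd_prod_of_mem (fun i => (X - C (a i)) ^ b i) hi).mul_left _
  have hdvd' : ∀ i ∈ S, ∀ j ≤ b i, (X - C (a i)) ^ j ∣ D := fun i hi j hj =>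
    (pow_dvd_pow _ hj).trans (hdvd i hi)
  have hcop : ∀ i ∈ S, ∀ i' ∈ S, i ≠ i' → IsCoprime (X - C (a i)) (X - C (a i')) :=
    fun i hi i' hi' h =>
      isCoprime_X_sub_C_of_isUnit_sub (sub_ne_zero.2 fun h' => h (ha hi hi' h')).isUnit
  rw [← sub_eq_zero]
  -- The difference of the two sides is divisible by `D` and has smaller degree.
  refine eq_zero_of_dvd_of_degree_lt (p := D) ?_ ?_
  · have hunit : IsUnit (C c : K[X]) := (isUnit_C).2 hc.isUnit
    rw [hD, hunit.mul_left_dvd, ← hD]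
    refine Finset.prod_dvd_of_coprime (fun i hi i' hi' h => (hcop i hi i' hi' h).pow) ?_
    intro i hi
    rw [← Finset.add_sum_erase _ _ hi, ← sub_sub]
    refine dvd_sub ?_ (Finset.dvd_sum fun i' hi' => Finset.dvd_sum fun j hj => ?_)
    · have hQ : D /ₘ (X - C (a i)) ^ b i = C c * ∏ i' ∈ S.erase i, (X - C (a i')) ^ b i' := by
        apply mul_left_cancel₀ (hmonic i (b i)).ne_zero
        rw [mul_divByMonic_of_dvd (hmonic i (b i)) (hdvd i hi), mul_left_comm,
          Finset.mul_prod_erase S (fun i => (X - C (a i)) ^ b i) hi, hD]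
      have hQ0 : (D /ₘ (X - C (a i)) ^ b i).eval (a i) ≠ 0 := by
        rw [hQ, eval_mul, eval_C, eval_prod]
        refine mul_ne_zero hc (Finset.prod_ne_zero_iff.2 fun i' hi' => ?_)
        rw [eval_pow, eval_sub, eval_X, eval_C]
        exact pow_ne_zero _ (sub_ne_zero.2 fun h =>
          (Finset.ne_of_mem_erase hi') (ha (Finset.mem_of_mem_erase hi') hi h.symm))
      convert X_sub_C_pow_dvd_sub_sum N _ (a i) (b i) hQ0 using 2
      refine Finset.sum_congr rfl fun j hj => ?_
      have hj' := (Finset.mem_Icc.1 hj).2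
      congr 1
      apply mul_left_cancel₀ (hmonic i j).ne_zero
      rw [mul_divByMonic_of_dvd (hmonic i j) (hdvd' i hi j hj'), ← mul_assoc, ← pow_add,
        Nat.add_sub_cancel' hj', mul_divByMonic_of_dvd (hmonic i (b i)) (hdvd i hi)]
    -- Principal parts at the other points keep the full factor `(X - C (a i)) ^ b i`.
    · refine Dvd.dvd.mul_left ?_ _
      have hi'S := Finset.mem_of_mem_erase hi'
      have h1 : (X - C (a i)) ^ b i ∣
          (X - C (a i')) ^ j * (D /ₘ (X - C (a i')) ^ j) := by
        rw [mul_divByMonic_of_dvd (hmonic i' j) (hdvd' i' hi'S j (Finset.mem_Icc.1 hj).2)]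
        exact hdvd i hi
      exact ((hcop i hi i' hi'S (Finset.ne_of_mem_erase hi').symm).pow).dvd_of_dvd_mul_left h1
  · have hbot : (⊥ : WithBot ℕ) < D.degree := bot_lt_iff_ne_bot.2 (degree_eq_bot.not.2 hD0)
    refine (degree_sub_le _ _).trans_lt (max_lt hN ?_)
    refine (degree_sum_le _ _).trans_lt ((Finset.sup_lt_iff hbot).2 fun i hi => ?_)
    refine (degree_sum_le _ _).trans_lt ((Finset.sup_lt_iff hbot).2 fun j hj => ?_)
    rw [C_mul']
    refine (degree_smul_le _ _).trans_lt (degree_divByMonic_lt _ _ hD0 ?_)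
    rw [degree_pow, degree_X_sub_C, nsmul_eq_mul, mul_one]
    exact_mod_cast (Finset.mem_Icc.1 hj).1

end PartialFractions

/-! ### Roots of the denominator and the formula for `p_k(n)` -/

section Denominator

open Polynomial

theorem mem_rootsUpTo {k : ℕ} {ω : ℂ} :
    ω ∈ rootsUpTo k ↔ ∃ m ∈ Finset.Icc 1 k, ω ^ m = 1 := by
  simp only [rootsUpTo, Finset.mem_biUnion]
  refine exists_congr fun m => and_congr_right fun hm => ?_
  rw [mem_nthRootsFinset (Finset.mem_Icc.1 hm).1]

theorem ne_zero_of_mem_rootsUpTo {k : ℕ} {ω : ℂ} (h : ω ∈ rootsUpTo k) : ω ≠ 0 := by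
  obtain ⟨m, hm, h⟩ := mem_rootsUpTo.1 h
  rintro rfl
  rw [zero_pow (by have := (Finset.mem_Icc.1 hm).1; omega)] at h
  exact zero_ne_one h

theorem orderOf_pos_of_mem_rootsUpTo {k : ℕ} {ω : ℂ} (h : ω ∈ rootsUpTo k) : 0 < orderOf ω := by
  obtain ⟨m, hm, h⟩ := mem_rootsUpTo.1 h
  exact orderOf_pos_iff.2 (isOfFinOrder_iff_pow_eq_one.2 ⟨m, (Finset.mem_Icc.1 hm).1, h⟩)

/-- Each factor `1 - X ^ m` has simple roots, so this count is the multiplicity of `ω⁻¹` in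
`partDenom k`. -/
theorem card_filter_pow_eq_one (k : ℕ) (ω : ℂ) :
    ((Finset.Icc 1 k).filter fun m => ω ^ m = 1).card = poleOrder k ω := by
  rw [poleOrder, ← Nat.Ioc_filter_dvd_card_eq_div]
  simp only [orderOf_dvd_iff_pow_eq_one]
  rfl

theorem one_sub_X_pow_eq_prod {m : ℕ} (hm : 0 < m) :
    (1 - X ^ m : ℂ[X]) = C (-1) * ∏ ζ ∈ nthRootsFinset m (1 : ℂ), (X - C ζ⁻¹) := by
  have h := X_pow_sub_one_eq_prod hm (Complex.isPrimitiveRoot_exp m hm.ne')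
  have h2 : ∏ ζ ∈ nthRootsFinset m (1 : ℂ), (X - C ζ⁻¹) =
      ∏ ζ ∈ nthRootsFinset m (1 : ℂ), (X - C ζ) := by
    have hinv : ∀ ζ ∈ nthRootsFinset m (1 : ℂ), ζ⁻¹ ∈ nthRootsFinset m (1 : ℂ) := fun ζ hζ => by
      rw [mem_nthRootsFinset hm] at *
      rw [inv_pow, hζ, inv_one]
    exact Finset.prod_bij' (fun ζ _ => ζ⁻¹) (fun ζ _ => ζ⁻¹) hinv hinv
      (fun _ _ => inv_inv _) (fun _ _ => inv_inv _) (fun _ _ => rfl)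
  rw [h2, ← h, C_neg, C_1]
  ring

theorem partDenom_eq_prod (k : ℕ) :
    partDenom k = C ((-1) ^ k) * ∏ ω ∈ rootsUpTo k, (X - C ω⁻¹) ^ poleOrder k ω := by
  have h : partDenom k = ∏ m ∈ Finset.Icc 1 k,
      (C (-1) * ∏ ζ ∈ nthRootsFinset m (1 : ℂ), (X - C ζ⁻¹)) :=
    Finset.prod_congr rfl fun m hm => one_sub_X_pow_eq_prod (Finset.mem_Icc.1 hm).1
  rw [h, Finset.prod_mul_distrib, Finset.prod_const, Nat.card_Icc, Nat.add_sub_cancel, C_pow]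
  congr 1
  rw [Finset.prod_comm' (t' := rootsUpTo k)
    (s' := fun ω => (Finset.Icc 1 k).filter fun m => ω ^ m = 1)]
  · exact Finset.prod_congr rfl fun ω _ => by rw [Finset.prod_const, card_filter_pow_eq_one]
  · intro m ω
    rw [Finset.mem_filter, mem_rootsUpTo]
    constructor
    · rintro ⟨h1, h2⟩
      rw [mem_nthRootsFinset (Finset.mem_Icc.1 h1).1] at h2
      exact ⟨⟨h1, h2⟩, m, h1, h2⟩
    · rintro ⟨⟨h1, h2⟩, -⟩
      exact ⟨h1, (mem_nthRootsFinset (Finset.mem_Icc.1 h1).1 _).2 h2⟩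

theorem natDegree_one_sub_X_pow (m : ℕ) : (1 - X ^ m : ℂ[X]).natDegree = m := by
  rw [← neg_sub, natDegree_neg, ← C_1, natDegree_X_pow_sub_C]

theorem one_sub_X_pow_ne_zero {m : ℕ} (hm : 0 < m) : (1 - X ^ m : ℂ[X]) ≠ 0 := by
  intro h
  have := natDegree_one_sub_X_pow m
  rw [h, natDegree_zero] at this
  omega

theorem partDenom_ne_zero (k : ℕ) : partDenom k ≠ 0 :=
  Finset.prod_ne_zero_iff.2 fun _ hm => one_sub_X_pow_ne_zero (Finset.mem_Icc.1 hm).1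

/-- The fraction is proper, so its decomposition has no polynomial part. This fails for `k = 1`. -/
theorem lt_natDegree_partDenom {k : ℕ} (hk : 2 ≤ k) : k < (partDenom k).natDegree := by
  rw [partDenom, natDegree_prod _ _
    fun _ hm => one_sub_X_pow_ne_zero (Finset.mem_Icc.1 hm).1,
    Finset.sum_congr rfl fun m _ => natDegree_one_sub_X_pow m]
  obtain ⟨k, rfl⟩ := Nat.exists_eq_add_of_le' hk
  rw [Finset.sum_Icc_succ_top (by omega)]
  have := Finset.single_le_sum (f := fun i : ℕ => i) (s := Finset.Icc 1 (k + 1))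
    (fun _ _ => Nat.zero_le _) (Finset.mem_Icc.2 ⟨le_rfl, by omega⟩)
  omega

theorem X_pow_eq_sum_principalCoeff {k : ℕ} (hk : 2 ≤ k) :
    (X ^ k : ℂ[X]) = ∑ ω ∈ rootsUpTo k, ∑ i ∈ Finset.Icc 1 (poleOrder k ω),
      C (principalCoeff k ω i) * (partDenom k /ₘ (X - C ω⁻¹) ^ i) := by
  refine eq_sum_principal_parts (rootsUpTo k) (fun ω => ω⁻¹) (poleOrder k)
    (fun _ _ _ _ h => inv_injective h) (pow_ne_zero k (by norm_num)) (partDenom_eq_prod k) ?_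
  rw [degree_X_pow, degree_eq_natDegree (partDenom_ne_zero k)]
  exact_mod_cast lt_natDegree_partDenom hk

theorem eval_shiftedBinom (i n : ℕ) :
    (shiftedBinom i).eval (n : ℂ) = ((i - 1 + n).choose (i - 1) : ℂ) := by
  have h : (∏ j ∈ Finset.Ico 1 i, ((n : ℂ) + j)) = ((n + 1).ascFactorial (i - 1) : ℂ) := by
    rw [Finset.prod_Ico_eq_prod_range, Nat.ascFactorial_eq_prod_range]
    push_cast
    exact Finset.prod_congr rfl fun j _ => by ring
  rw [shiftedBinom, eval_mul, eval_C, eval_prod]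
  simp only [eval_add, eval_X, eval_C]
  rw [h, Nat.ascFactorial_eq_factorial_mul_choose, Nat.cast_mul, inv_mul_cancel_left₀
    (by exact_mod_cast (Nat.factorial_pos _).ne'), add_comm n]

/-- The expansion of `(1 - ω z)^(-i)`. -/
theorem one_sub_mul_pow_mul_mk {i : ℕ} (hi : 1 ≤ i) (ω : ℂ) :
    (1 - PowerSeries.C ω * PowerSeries.X) ^ i *
      PowerSeries.mk (fun n : ℕ => (shiftedBinom i).eval (n : ℂ) * ω ^ n) = 1 := by
  obtain ⟨d, rfl⟩ := Nat.exists_eq_add_of_le' hi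
  have h := congrArg (PowerSeries.rescale ω) (PowerSeries.mk_add_choose_mul_one_sub_pow_eq_one ℂ d)
  rw [map_mul, map_pow, map_sub, map_one, PowerSeries.rescale_X, PowerSeries.rescale_mk,
    mul_comm] at h
  refine Eq.trans (congrArg _ (congrArg PowerSeries.mk (funext fun n => ?_))) h
  rw [eval_shiftedBinom, mul_comm, Nat.add_sub_cancel]

theorem card_exactParts_eq {k : ℕ} (hk : 2 ≤ k) (n : ℕ) :
    ((exactParts k n).card : ℂ) = ∑ ω ∈ rootsUpTo k, (rootPoly k ω).eval (n : ℂ) * ω ^ n := by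
  have hseries : partSeries k = ∑ ω ∈ rootsUpTo k, ∑ i ∈ Finset.Icc 1 (poleOrder k ω),
      PowerSeries.C ((-ω) ^ i * principalCoeff k ω i) *
        PowerSeries.mk (fun n : ℕ => (shiftedBinom i).eval (n : ℂ) * ω ^ n) := by
    have h0 : (partDenom k : PowerSeries ℂ) ≠ 0 := by
      rw [Ne, Polynomial.coe_eq_zero_iff]
      exact partDenom_ne_zero k
    apply mul_left_cancel₀ h0
    have hX := congrArg (fun p : ℂ[X] => (p : PowerSeries ℂ)) (X_pow_eq_sum_principalCoeff hk)
    simp only [← Polynomial.coeToPowerSeries.ringHom_apply, map_sum, map_mul] at hX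
    simp only [Polynomial.coeToPowerSeries.ringHom_apply, Polynomial.coe_pow,
      Polynomial.coe_X, Polynomial.coe_C] at hX
    rw [partDenom_mul_partSeries, hX, Finset.mul_sum]
    refine Finset.sum_congr rfl fun ω hω => ?_
    rw [Finset.mul_sum]
    refine Finset.sum_congr rfl fun i hi => ?_
    obtain ⟨hi1, hi2⟩ := Finset.mem_Icc.1 hi
    have hω0 := ne_zero_of_mem_rootsUpTo hω
    have hdvd : (X - C ω⁻¹) ^ i ∣ partDenom k := by
      rw [partDenom_eq_prod]
      exact ((pow_dvd_pow _ hi2).trans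
        (Finset.dvd_prod_of_mem (fun ω => (X - C ω⁻¹) ^ poleOrder k ω) hω)).mul_left _
    have hmul := congrArg (fun p : ℂ[X] => (p : PowerSeries ℂ))
      (mul_divByMonic_of_dvd ((monic_X_sub_C ω⁻¹).pow i) hdvd)
    simp only [Polynomial.coe_mul, Polynomial.coe_pow, Polynomial.coe_sub, Polynomial.coe_X,
      Polynomial.coe_C] at hmul
    -- This rewrites `(z - ω⁻¹)^(-i)` as `(-ω)^i (1 - ω z)^(-i)`, the source of the factor `(-ω)^i`
    -- in `rootPoly`.
    have hlin : (PowerSeries.C (-ω) * (PowerSeries.X - PowerSeries.C ω⁻¹) : PowerSeries ℂ) =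
        1 - PowerSeries.C ω * PowerSeries.X := by
      rw [mul_sub, ← map_mul, neg_mul, mul_inv_cancel₀ hω0, map_neg, map_neg, map_one]
      ring
    have hone := one_sub_mul_pow_mul_mk hi1 ω
    rw [← hlin, mul_pow] at hone
    rw [← hmul, map_mul, map_pow]
    linear_combination (-(PowerSeries.C (principalCoeff k ω i)) *
      ((partDenom k /ₘ (X - C ω⁻¹) ^ i : ℂ[X]) : PowerSeries ℂ)) * hone
  have := congrArg (PowerSeries.coeff n) hseries
  rw [partSeries, PowerSeries.coeff_mk, map_sum] at this
  rw [this]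
  refine Finset.sum_congr rfl fun ω _ => ?_
  rw [rootPoly, eval_finsetSum, Finset.sum_mul, map_sum]
  refine Finset.sum_congr rfl fun i _ => ?_
  rw [PowerSeries.coeff_C_mul, PowerSeries.coeff_mk, eval_mul, eval_C]
  ring

theorem natDegree_shiftedBinom_lt {i : ℕ} (hi : 1 ≤ i) :
    (shiftedBinom i).natDegree < i := by
  have h1 : (∏ j ∈ Finset.Ico 1 i, (X + C (j : ℂ))).natDegree ≤ i - 1 := by
    refine (natDegree_prod_le _ _).trans ?_
    simp only [natDegree_X_add_C]
    simp
  have h2 := natDegree_C_mul_le ((Nat.factorial (i - 1) : ℂ)⁻¹)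
    (∏ j ∈ Finset.Ico 1 i, (X + C (j : ℂ)))
  rw [shiftedBinom]
  omega

theorem degree_rootPoly_lt (k : ℕ) (ω : ℂ) : (rootPoly k ω).degree < poleOrder k ω := by
  rw [degree_lt_iff_coeff_zero]
  intro t ht
  rw [rootPoly, finsetSum_coeff]
  refine Finset.sum_eq_zero fun i hi => ?_
  obtain ⟨hi1, hi2⟩ := Finset.mem_Icc.1 hi
  have := natDegree_shiftedBinom_lt hi1
  rw [coeff_C_mul, coeff_eq_zero_of_natDegree_lt (by omega), mul_zero]

theorem eval_rootPoly (k : ℕ) (ω x : ℂ) :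
    (rootPoly k ω).eval x = ∑ t ∈ Finset.range (poleOrder k ω), (rootPoly k ω).coeff t * x ^ t := by
  by_cases h : rootPoly k ω = 0
  · simp [h]
  · exact eval_eq_sum_range' ((natDegree_lt_iff_degree_lt h).2 (degree_rootPoly_lt k ω)) x

end Denominator

/-! ### Closure properties of linear combinations -/

namespace IsLinCombOn

variable {ι : Type} {F : ι → ℕ → ℂ} {N : ℕ}

theorem zero : IsLinCombOn F N fun _ => 0 := ⟨0, fun _ _ => by simp⟩

theorem add {f g : ℕ → ℂ} (hf : IsLinCombOn F N f) (hg : IsLinCombOn F N g) :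
    IsLinCombOn F N fun n => f n + g n := by
  obtain ⟨c, hc⟩ := hf
  obtain ⟨d, hd⟩ := hg
  classical
  refine ⟨c + d, fun n hn => ?_⟩
  show f n + g n = _
  rw [hc n hn, hd n hn, Finsupp.sum_add_index' (fun _ => zero_mul _) (fun _ _ _ => add_mul _ _ _)]

theorem mul_apply (a : ℂ) (i : ι) : IsLinCombOn F N fun n => a * F i n :=
  ⟨Finsupp.single i a, fun n _ => by rw [Finsupp.sum_single_index (zero_mul _)]⟩

theorem sum {κ : Type*} {s : Finset κ} {f : κ → ℕ → ℂ} (h : ∀ j ∈ s, IsLinCombOn F N (f j)) :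
    IsLinCombOn F N fun n => ∑ j ∈ s, f j n := by
  classical
  induction s using Finset.induction_on with
  | empty => simpa using zero
  | insert j s hj ih =>
    simp only [Finset.sum_insert hj]
    exact (h j (Finset.mem_insert_self j s)).add
      (ih fun i hi => h i (Finset.mem_insert_of_mem hi))

theorem congr {f g : ℕ → ℂ} (hf : IsLinCombOn F N f) (h : ∀ n, N ≤ n → g n = f n) :
    IsLinCombOn F N g := by
  obtain ⟨c, hc⟩ := hf
  exact ⟨c, fun n hn => (h n hn).trans (hc n hn)⟩

end IsLinCombOn

/-! ### Jordan root and Jordan modulo totient functions -/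

theorem coprimePartitions_eq_sum_jordanRoot {k : ℕ} (hk : 2 ≤ k) {n : ℕ} (hn : 1 ≤ n) :
    (coprimePartitions k n : ℂ) = ∑ ω ∈ rootsUpTo k, ∑ t ∈ Finset.range (poleOrder k ω),
      (rootPoly k ω).coeff t * jordanRoot t ω n := by
  rw [coprimePartitions_eq_sum k hn]
  simp only [card_exactParts_eq hk, eval_rootPoly, jordanRoot, Finset.sum_mul, Finset.mul_sum]
  rw [Finset.sum_comm]
  refine Finset.sum_congr rfl fun ω _ => ?_
  rw [Finset.sum_comm]
  refine Finset.sum_congr rfl fun t _ => Finset.sum_congr rfl fun d _ => ?_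
  ring

/-- The power `ω ^ d` depends only on `d` modulo the order of `ω`. -/
theorem jordanRoot_eq_sum_jordanMod (t : ℕ) {ω : ℂ} (hω : 0 < orderOf ω) (n : ℕ) :
    jordanRoot t ω n =
      ∑ j ∈ Finset.range (orderOf ω), ω ^ j * (jordanMod t j (orderOf ω) n : ℂ) := by
  rw [jordanRoot, ← Finset.sum_fiberwise_of_maps_to (t := Finset.range (orderOf ω))
    (g := fun d => d % orderOf ω) (fun d _ => Finset.mem_range.2 (Nat.mod_lt _ hω))]
  refine Finset.sum_congr rfl fun j hj => ?_
  rw [jordanMod, Int.cast_sum, Finset.mul_sum]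
  have hj' : j % orderOf ω = j := Nat.mod_eq_of_lt (Finset.mem_range.1 hj)
  refine Finset.sum_congr (Finset.filter_congr fun d _ => ?_) fun d hd => ?_
  · rw [Nat.ModEq, hj']
  · have hd' : d % orderOf ω = j :=
      Eq.trans (Finset.mem_filter.1 hd).2 hj'
    rw [← pow_mod_orderOf ω d, hd']
    push_cast
    ring

theorem coprimePartitions_eq_sum_jordanMod {k : ℕ} (hk : 2 ≤ k) {n : ℕ} (hn : 1 ≤ n) :
    (coprimePartitions k n : ℂ) = ∑ ω ∈ rootsUpTo k, ∑ t ∈ Finset.range (poleOrder k ω),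
      ∑ j ∈ Finset.range (orderOf ω),
        (rootPoly k ω).coeff t * ω ^ j * (jordanMod t j (orderOf ω) n : ℂ) := by
  rw [coprimePartitions_eq_sum_jordanRoot hk hn]
  refine Finset.sum_congr rfl fun ω hω => Finset.sum_congr rfl fun t _ => ?_
  rw [jordanRoot_eq_sum_jordanMod t (orderOf_pos_of_mem_rootsUpTo hω), Finset.mul_sum]
  exact Finset.sum_congr rfl fun j _ => (mul_assoc _ _ _).symm

theorem isLinCombOn_jordanRoot {k : ℕ} (hk : 2 ≤ k) :
    IsLinCombOn (fun (p : ℕ × {ω : ℂ // ω ∈ rootsUpTo k}) n => jordanRoot p.1 p.2 n) 1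
      (fun n => (coprimePartitions k n : ℂ)) := by
  refine IsLinCombOn.congr ?_ fun n hn => coprimePartitions_eq_sum_jordanRoot hk hn
  refine IsLinCombOn.sum fun ω hω => IsLinCombOn.sum fun t _ => ?_
  exact IsLinCombOn.mul_apply
    (F := fun (p : ℕ × {ω : ℂ // ω ∈ rootsUpTo k}) n => jordanRoot p.1 p.2 n) _ (t, ⟨ω, hω⟩)

theorem isLinCombOn_jordanMod {k : ℕ} (hk : 2 ≤ k) :
    IsLinCombOn (fun (p : ℕ × (Σ m : ℕ, Fin m)) n => (jordanMod p.1 p.2.2 p.2.1 n : ℂ)) 1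
      (fun n => (coprimePartitions k n : ℂ)) := by
  refine IsLinCombOn.congr ?_ fun n hn => coprimePartitions_eq_sum_jordanMod hk hn
  refine IsLinCombOn.sum fun ω _ => IsLinCombOn.sum fun t _ => IsLinCombOn.sum fun j hj => ?_
  exact IsLinCombOn.mul_apply
    (F := fun (p : ℕ × (Σ m : ℕ, Fin m)) n => (jordanMod p.1 p.2.2 p.2.1 n : ℂ)) _
    (t, ⟨orderOf ω, ⟨j, Finset.mem_range.1 hj⟩⟩)

/-! ### Rigidity of Jordan combinations, and the obstruction for `k ≥ 4` -/

section JordanCombinations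

open Polynomial

/-- The Dirichlet convolution of `n ↦ C(n)` with the Möbius function: the linear combination
`∑ t, c_t J_t` for `C = ∑ t, c_t X^t`. -/
noncomputable def polyMoebius (C : ℂ[X]) (n : ℕ) : ℂ :=
  ∑ d ∈ n.divisors, C.eval (d : ℂ) * (ArithmeticFunction.moebius (n / d) : ℂ)

theorem polyMoebius_sub (C D : ℂ[X]) (n : ℕ) :
    polyMoebius (C - D) n = polyMoebius C n - polyMoebius D n := by
  simp only [polyMoebius, eval_sub, sub_mul, Finset.sum_sub_distrib]

theorem polyMoebius_C_mul_X_pow (a : ℂ) (t n : ℕ) :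
    polyMoebius (C a * X ^ t) n = a * (jordan t n : ℂ) := by
  simp [polyMoebius, jordan, Finset.mul_sum, mul_assoc]

theorem sum_divisors_polyMoebius (C : ℂ[X]) {n : ℕ} (hn : 0 < n) :
    ∑ d ∈ n.divisors, polyMoebius C d = C.eval (n : ℂ) := by
  refine (ArithmeticFunction.sum_eq_iff_sum_mul_moebius_eq (f := polyMoebius C)
    (g := fun n : ℕ => C.eval (n : ℂ))).2 (fun m _ => ?_) n hn
  rw [Nat.sum_divisorsAntidiagonal'
    (f := fun a b : ℕ => (ArithmeticFunction.moebius a : ℂ) * C.eval (b : ℂ))]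
  exact Finset.sum_congr rfl fun d _ => mul_comm _ _

theorem IsLinCombOn.exists_polyMoebius {N : ℕ} {f : ℕ → ℂ}
    (h : IsLinCombOn (fun (t : ℕ) n => (jordan t n : ℂ)) N f) :
    ∃ C : ℂ[X], ∀ n, N ≤ n → f n = polyMoebius C n := by
  obtain ⟨c, hc⟩ := h
  refine ⟨c.sum fun t a => C a * X ^ t, fun n hn => ?_⟩
  rw [hc n hn, Finsupp.sum, Finsupp.sum]
  simp only [polyMoebius, eval_finsetSum, Finset.sum_mul]
  rw [Finset.sum_comm]
  exact Finset.sum_congr rfl fun t _ => (polyMoebius_C_mul_X_pow (c t) t n).symm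

/-- The indicator of the multiples of `a` is the divisor sum of the point mass at `a`. -/
theorem sum_ite_dvd_mul_moebius {R : Type*} [CommRing R] {a : ℕ} {n : ℕ} (hn : 0 < n) :
    ∑ d ∈ n.divisors, (if a ∣ d then 1 else 0) * (ArithmeticFunction.moebius (n / d) : R) =
      if n = a then 1 else 0 := by
  refine (sum_mul_moebius_of_sum_divisors (f := fun n => if n = a then (1 : R) else 0)
    (g := fun n => if a ∣ n then 1 else 0) (fun n hn => ?_) hn).symm
  rw [Finset.sum_ite_eq']
  simp [Nat.mem_divisors, hn.ne']

theorem polyMoebius_prime (C : ℂ[X]) {p : ℕ} (hp : p.Prime) :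
    polyMoebius C p = C.eval (p : ℂ) - C.eval 1 := by
  rw [polyMoebius, hp.sum_divisors, Nat.div_self hp.pos, Nat.div_one,
    ArithmeticFunction.moebius_apply_prime hp]
  simp
  ring

/-- A combination of Jordan totient functions which vanishes eventually is a multiple of `J_0`. -/
theorem polyMoebius_eq_zero {C : ℂ[X]} {N : ℕ} (h : ∀ n, N ≤ n → polyMoebius C n = 0) {n : ℕ}
    (hn : 2 ≤ n) : polyMoebius C n = 0 := by
  -- At a prime `p ≥ N` the hypothesis reads `C(p) = C(1)`; infinitely many such primes make `C`
  -- constant.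
  have hC : C - Polynomial.C (C.eval 1) = 0 := by
    refine eq_zero_of_infinite_isRoot _ (Set.Infinite.mono ?_
      (((Nat.infinite_setOfPred_prime.sdiff (Set.finite_lt_nat N))).image
        (Nat.cast_injective (R := ℂ)).injOn))
    rintro _ ⟨p, ⟨hp, hpN⟩, rfl⟩
    have := h p (not_lt.1 hpN)
    rw [polyMoebius_prime C hp] at this
    simpa [IsRoot] using this
  rw [sub_eq_zero.1 hC]
  have := sum_ite_dvd_mul_moebius (R := ℂ) (a := 1) (n := n) (by omega)
  rw [if_neg (by omega)] at this
  simp only [one_dvd, if_true, one_mul] at this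
  simp only [polyMoebius, eval_C]
  rw [← Finset.mul_sum, this, mul_zero]

/-- If `f` is a combination of Jordan totient functions up to an error with support bounded by
`k`, with `k` in the support, then it is not such a combination on a domain which contains `k`. -/
theorem IsLinCombOn.lt_of_eq_polyMoebius_add {f e : ℕ → ℂ} {Q : ℂ[X]} {k N : ℕ} (hk : 2 ≤ k)
    (hf : ∀ n, 0 < n → f n = polyMoebius Q n + e n) (he : ∀ n, k < n → e n = 0) (hek : e k ≠ 0)
    (h : IsLinCombOn (fun (t : ℕ) n => (jordan t n : ℂ)) N f) : k < N := by
  by_contra hN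
  obtain ⟨C, hC⟩ := h.exists_polyMoebius
  have h0 : ∀ n, k + 1 ≤ n → polyMoebius (C - Q) n = 0 := fun n hn => by
    rw [polyMoebius_sub, ← hC n (by omega), hf n (by omega), he n (by omega)]
    ring
  have h1 := polyMoebius_eq_zero h0 hk
  rw [polyMoebius_sub, ← hC k (by omega), hf k (by omega)] at h1
  exact hek (by linear_combination h1)

/-- A power series whose coefficients are eventually given by a polynomial is rational, with
denominator a power of `1 - X`. -/
theorem exists_one_sub_pow_mul_eq_coe (T : ℕ) :
    ∀ (Q : ℂ[X]) (F : PowerSeries ℂ) (M : ℕ), Q.degree < T →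
      (∀ n, M ≤ n → PowerSeries.coeff n F = Q.eval (n : ℂ)) →
      ∃ R : ℂ[X], (1 - PowerSeries.X) ^ T * F = (R : PowerSeries ℂ) := by
  induction T with
  | zero =>
    intro Q F M hQ hF
    have hQ0 : Q = 0 := by
      rw [← degree_eq_bot]
      by_contra h
      rw [degree_eq_natDegree (fun h0 => h (degree_eq_bot.2 h0))] at hQ
      exact absurd (by exact_mod_cast hQ) (Nat.not_lt_zero Q.natDegree)
    refine ⟨PowerSeries.trunc M F, ?_⟩
    ext n
    rw [pow_zero, one_mul, Polynomial.coeff_coe, PowerSeries.coeff_trunc]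
    split_ifs with h
    · rfl
    · rw [hF n (by omega), hQ0, eval_zero]
  | succ T ih =>
    intro Q F M hQ hF
    -- Multiplication by `1 - X` takes backward differences `Q(n) - Q(n - 1)`, which lowers the
    -- degree and moves the threshold up by one.
    have hdeg : (Q - taylor (-1) Q).degree < T := by
      by_cases hQ0 : Q = 0
      · simp [hQ0]
      · have := degree_sub_lt_left (degree_taylor Q (-1)).symm hQ0 (leadingCoeff_taylor (-1) Q).symm
        rw [degree_eq_natDegree hQ0] at this hQ
        have h2 : Q.natDegree < T + 1 := by exact_mod_cast hQ
        refine this.trans_le ?_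
        exact_mod_cast Nat.lt_succ_iff.1 h2
    obtain ⟨R, hR⟩ := ih (Q - taylor (-1) Q) ((1 - PowerSeries.X) * F) (M + 1) hdeg (by
      intro n hn
      obtain ⟨n, rfl⟩ := Nat.exists_eq_add_of_le' (show 1 ≤ n by omega)
      rw [sub_mul, one_mul, map_sub, PowerSeries.coeff_succ_X_mul, hF _ (by omega),
        hF _ (by omega), eval_sub, taylor_eval]
      push_cast
      congr 2
      ring)
    exact ⟨R, by rw [← hR, pow_succ, mul_assoc]⟩

/-- Both `1 - X ^ 2` and `1 - X ^ 4` vanish at `-1`; the second is a factor only once `k ≥ 4`. -/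
theorem X_add_one_sq_dvd_partDenom {k : ℕ} (hk : 4 ≤ k) : ((X + 1) ^ 2 : ℂ[X]) ∣ partDenom k := by
  have h : ((1 - X ^ 2) * (1 - X ^ 4) : ℂ[X]) ∣ partDenom k := by
    rw [← Finset.prod_pair (f := fun m => (1 - X ^ m : ℂ[X])) (show 2 ≠ 4 by norm_num)]
    refine Finset.prod_dvd_prod_of_subset _ _ _ fun m hm => ?_
    simp only [Finset.mem_insert, Finset.mem_singleton] at hm
    rw [Finset.mem_Icc]
    omega
  exact Dvd.dvd.trans ⟨(1 - X) ^ 2 * (1 + X ^ 2), by ring⟩ h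

/-- Only divisors below `N` contribute, and all of those divide `N!`. -/
theorem sum_divisors_add_factorial {g : ℕ → ℂ} {N : ℕ} (hg : ∀ n, N ≤ n → g n = 0) {n : ℕ}
    (hn : 0 < n) :
    ∑ d ∈ (n + N.factorial).divisors, g d = ∑ d ∈ n.divisors, g d := by
  have h : ∀ m : ℕ, ∑ d ∈ m.divisors, g d = ∑ d ∈ m.divisors with d < N, g d := fun m =>
    (Finset.sum_filter_of_ne fun d _ hd => not_le.1 fun h => hd (hg d h)).symm
  rw [h, h n]
  refine Finset.sum_congr ?_ fun _ _ => rfl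
  ext d
  simp only [Finset.mem_filter, Nat.mem_divisors]
  refine and_congr_left fun hd => ?_
  rcases Nat.eq_zero_or_pos d with rfl | hd0
  · simp
  · rw [← Nat.dvd_add_iff_left (Nat.dvd_factorial hd0 hd.le)]
    simp [hn.ne', Nat.factorial_ne_zero]

/-- For `k ≥ 4`, the double pole of the generating function at `-1` prevents `p'_k` from being a
combination of Jordan totient functions. -/
theorem not_isLinCombOn_jordan {k : ℕ} (hk : 4 ≤ k) (N : ℕ) :
    ¬ IsLinCombOn (fun (t : ℕ) n => (jordan t n : ℂ)) N
      (fun n => (coprimePartitions k n : ℂ)) := by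
  intro h
  obtain ⟨P, hP⟩ := h.exists_polyMoebius
  set L := N.factorial with hL
  have hL0 : 0 < L := Nat.factorial_pos N
  have hsum : ∀ n, 0 < n → ∑ d ∈ n.divisors, ((coprimePartitions k d : ℂ) - polyMoebius P d) =
      ((exactParts k n).card : ℂ) - P.eval (n : ℂ) := fun n hn => by
    rw [Finset.sum_sub_distrib, sum_divisors_polyMoebius P hn, ← sum_divisors_coprimePartitions k hn]
    push_cast
    rfl
  have hper : ∀ n, 0 < n → ((exactParts k (n + L)).card : ℂ) - (exactParts k n).card =
      P.eval ((n : ℂ) + L) - P.eval (n : ℂ) := fun n hn => by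
    have := sum_divisors_add_factorial
      (g := fun d => (coprimePartitions k d : ℂ) - polyMoebius P d)
      (fun n hn => sub_eq_zero.2 (hP n hn)) hn
    rw [hsum n hn, hsum _ (by omega)] at this
    push_cast at this
    linear_combination this
  set Q := P - taylor (-(L : ℂ)) P with hQ
  -- The threshold is `L + 1` because `hper` requires a positive argument.
  obtain ⟨R, hR⟩ := exists_one_sub_pow_mul_eq_coe (Q.natDegree + 1) Q
    ((1 - PowerSeries.X ^ L) * partSeries k) (L + 1)
    (degree_le_natDegree.trans_lt (by exact_mod_cast Nat.lt_succ_self _)) (by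
      intro n hn
      obtain ⟨n, rfl⟩ := Nat.exists_eq_add_of_le' (show L ≤ n by omega)
      rw [sub_mul, one_mul, map_sub, PowerSeries.coeff_X_pow_mul, partSeries,
        PowerSeries.coeff_mk, PowerSeries.coeff_mk, hper n (by omega), hQ, eval_sub, taylor_eval]
      push_cast
      congr 2
      ring)
  have hpoly : ((1 - X) ^ (Q.natDegree + 1) * X ^ k) * (1 - X ^ L) = partDenom k * R := by
    apply Polynomial.coe_injective ℂ
    simp only [Polynomial.coe_mul, Polynomial.coe_pow, Polynomial.coe_sub, Polynomial.coe_one,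
      Polynomial.coe_X]
    rw [← hR, ← partDenom_mul_partSeries k]
    ring
  have hdvd : ((X + 1) ^ 2 : ℂ[X]) ∣ ((1 - X) ^ (Q.natDegree + 1) * X ^ k) * (1 - X ^ L) :=
    hpoly ▸ (X_add_one_sq_dvd_partDenom hk).mul_right R
  have hcop : IsCoprime ((X + 1) ^ 2 : ℂ[X]) ((1 - X) ^ (Q.natDegree + 1) * X ^ k) := by
    refine IsCoprime.pow_left (IsCoprime.mul_right (IsCoprime.pow_right ?_) (IsCoprime.pow_right ?_))
    · refine ⟨C (1 / 2), C (1 / 2), ?_⟩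
      rw [← mul_add, show (X + 1 + (1 - X) : ℂ[X]) = C 2 by rw [C_ofNat]; ring, ← C_mul]
      norm_num
    · exact ⟨1, -1, by ring⟩
  -- Once the factors prime to `X + 1` are removed, `(X + 1) ^ 2` would divide the separable
  -- polynomial `X ^ L - 1`.
  have hsq : Squarefree (X ^ L - 1 : ℂ[X]) :=
    (X_pow_sub_one_separable_iff.2 (by exact_mod_cast hL0.ne')).squarefree
  have hunit : IsUnit (X + 1 : ℂ[X]) := hsq _ (by
    rw [← sq, ← dvd_neg, neg_sub]
    exact hcop.dvd_of_dvd_mul_left hdvd)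
  have hdeg := natDegree_eq_zero_of_isUnit hunit
  rw [← C_1, natDegree_X_add_C] at hdeg
  exact one_ne_zero hdeg

end JordanCombinations

/-! ### The cases `k = 2` and `k = 3` -/

section SmallCases

theorem card_exactParts_one (n : ℕ) : (exactParts 1 (n + 1)).card = 1 := by
  induction n with
  | zero =>
    have := card_exactParts_succ 0 0
    rw [exactParts_eq_empty (k := 0 + 1) (n := 0) (by omega)] at this
    simpa [card_exactParts_zero] using this
  | succ n ih =>
    have := card_exactParts_succ 0 (n + 1)
    rw [card_exactParts_zero, if_neg (by omega), zero_add, ih] at this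
    exact this

/-- The periodic part is written with a divisibility indicator, so that convolution with the Möbius
function makes it a point mass. -/
theorem card_exactParts_two (n : ℕ) :
    ((exactParts 2 n).card : ℚ) = (n : ℚ) / 2 - 1 / 2 + 1 / 2 * (if 2 ∣ n then 1 else 0) := by
  induction n using Nat.twoStepInduction with
  | zero => norm_num [exactParts_eq_empty]
  | one => norm_num [exactParts_eq_empty]
  | more n ih _ =>
    rw [card_exactParts_succ 1 n, card_exactParts_one, Nat.cast_add, ih]
    simp only [Nat.dvd_add_self_right]
    push_cast
    ring

theorem card_exactParts_three (n : ℕ) :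
    ((exactParts 3 n).card : ℚ) = (n : ℚ) ^ 2 / 12 - 1 / 12 -
      1 / 4 * (if 2 ∣ n then 1 else 0) + 1 / 3 * (if 3 ∣ n then 1 else 0) := by
  induction n using Nat.strong_induction_on with
  | _ n ih =>
    rcases lt_or_ge n 3 with h | h
    · rw [exactParts_eq_empty h]
      interval_cases n <;> norm_num
    · obtain ⟨n, rfl⟩ := Nat.exists_eq_add_of_le' h
      rw [card_exactParts_succ 2 n, Nat.cast_add, ih n (by omega), card_exactParts_two]
      simp only [Nat.dvd_add_self_right]
      -- The parity terms from two and three parts sit at arguments of opposite parity.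
      have h2 : (if 2 ∣ n + 1 then 1 else 0 : ℚ) = 1 - if 2 ∣ n then 1 else 0 := by
        by_cases hn : 2 ∣ n
        · rw [if_pos hn, if_neg (by omega)]; norm_num
        · rw [if_neg hn, if_pos (by omega)]; norm_num
      rw [h2]
      push_cast
      ring

theorem jordan_cast_eq_sum (t n : ℕ) :
    (jordan t n : ℚ) =
      ∑ d ∈ n.divisors, (d : ℚ) ^ t * (ArithmeticFunction.moebius (n / d) : ℚ) := by
  rw [jordan]
  push_cast
  rfl

theorem sum_moebius_eq_ite {n : ℕ} (hn : 0 < n) :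
    ∑ d ∈ n.divisors, (ArithmeticFunction.moebius (n / d) : ℚ) = if n = 1 then 1 else 0 := by
  simpa using sum_ite_dvd_mul_moebius (R := ℚ) (a := 1) hn

theorem coprimePartitions_two {n : ℕ} (hn : 0 < n) :
    (coprimePartitions 2 n : ℚ) = (jordan 1 n : ℚ) / 2 +
      (-(1 / 2) * (if n = 1 then 1 else 0) + 1 / 2 * (if n = 2 then 1 else 0)) := by
  rw [coprimePartitions_eq_sum 2 hn, jordan_cast_eq_sum, ← sum_moebius_eq_ite hn,
    ← sum_ite_dvd_mul_moebius hn]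
  simp only [Finset.mul_sum, Finset.sum_div, ← Finset.sum_add_distrib]
  refine Finset.sum_congr rfl fun d _ => ?_
  rw [card_exactParts_two]
  ring

theorem coprimePartitions_three {n : ℕ} (hn : 0 < n) :
    (coprimePartitions 3 n : ℚ) = (jordan 2 n : ℚ) / 12 +
      (-(1 / 12) * (if n = 1 then 1 else 0) - 1 / 4 * (if n = 2 then 1 else 0) +
        1 / 3 * (if n = 3 then 1 else 0)) := by
  rw [coprimePartitions_eq_sum 3 hn, jordan_cast_eq_sum, ← sum_moebius_eq_ite hn,
    ← sum_ite_dvd_mul_moebius (a := 2) hn, ← sum_ite_dvd_mul_moebius (a := 3) hn]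
  simp only [Finset.mul_sum, Finset.sum_div, ← Finset.sum_add_distrib, ← Finset.sum_sub_distrib]
  refine Finset.sum_congr rfl fun d _ => ?_
  rw [card_exactParts_three]
  ring

theorem coprimePartitions_two_eq {n : ℕ} (hn : 3 ≤ n) :
    (coprimePartitions 2 n : ℚ) = (jordan 1 n : ℚ) / 2 := by
  rw [coprimePartitions_two (by omega), if_neg (by omega), if_neg (by omega)]
  ring

theorem coprimePartitions_three_eq {n : ℕ} (hn : 4 ≤ n) :
    (coprimePartitions 3 n : ℚ) = (jordan 2 n : ℚ) / 12 := by
  rw [coprimePartitions_three (by omega), if_neg (by omega), if_neg (by omega),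
    if_neg (by omega)]
  ring

theorem isLinCombOn_jordan_of_eq {k t N : ℕ} {q : ℚ}
    (h : ∀ n, N ≤ n → (coprimePartitions k n : ℚ) = q * (jordan t n : ℚ)) :
    IsLinCombOn (fun (t : ℕ) n => (jordan t n : ℂ)) N
      (fun n => (coprimePartitions k n : ℂ)) := by
  refine IsLinCombOn.congr (IsLinCombOn.mul_apply
    (F := fun (t : ℕ) n => (jordan t n : ℂ)) (q : ℂ) t) fun n hn => ?_
  have := congrArg (fun x : ℚ => (x : ℂ)) (h n hn)
  push_cast at this
  exact this

/-- The obstruction is the correction to `J_1 / 2`, whose value at 2 is `1/2`. -/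
theorem two_lt_of_isLinCombOn_jordan {N : ℕ}
    (h : IsLinCombOn (fun (t : ℕ) n => (jordan t n : ℂ)) N
      (fun n => (coprimePartitions 2 n : ℂ))) : 2 < N := by
  refine IsLinCombOn.lt_of_eq_polyMoebius_add (Q := Polynomial.C (1 / 2) * Polynomial.X ^ 1)
    (e := fun n => -(1 / 2) * (if n = 1 then 1 else 0) + 1 / 2 * (if n = 2 then 1 else 0))
    le_rfl (fun n hn => ?_) (fun n hn => ?_) (by norm_num) h
  · have := congrArg (fun x : ℚ => (x : ℂ)) (coprimePartitions_two hn)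
    push_cast at this
    simp only [apply_ite (Rat.cast : ℚ → ℂ), Rat.cast_one, Rat.cast_zero] at this
    rw [polyMoebius_C_mul_X_pow, this]
    ring
  · show -(1 / 2) * (if n = 1 then (1 : ℂ) else 0) + 1 / 2 * (if n = 2 then 1 else 0) = 0
    rw [if_neg (by omega), if_neg (by omega)]
    ring

theorem three_lt_of_isLinCombOn_jordan {N : ℕ}
    (h : IsLinCombOn (fun (t : ℕ) n => (jordan t n : ℂ)) N
      (fun n => (coprimePartitions 3 n : ℂ))) : 3 < N := by
  refine IsLinCombOn.lt_of_eq_polyMoebius_add (Q := Polynomial.C (1 / 12) * Polynomial.X ^ 2)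
    (e := fun n => -(1 / 12) * (if n = 1 then 1 else 0) - 1 / 4 * (if n = 2 then 1 else 0) +
      1 / 3 * (if n = 3 then 1 else 0))
    (by norm_num) (fun n hn => ?_) (fun n hn => ?_) (by norm_num) h
  · have := congrArg (fun x : ℚ => (x : ℂ)) (coprimePartitions_three hn)
    push_cast at this
    simp only [apply_ite (Rat.cast : ℚ → ℂ), Rat.cast_one, Rat.cast_zero] at this
    rw [polyMoebius_C_mul_X_pow, this]
    ring
  · show -(1 / 12) * (if n = 1 then (1 : ℂ) else 0) - 1 / 4 * (if n = 2 then 1 else 0) +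
      1 / 3 * (if n = 3 then 1 else 0) = 0
    rw [if_neg (by omega), if_neg (by omega), if_neg (by omega)]
    ring

theorem eq_and_lt_of_isLinCombOn_jordan {k N : ℕ} (hk : 2 ≤ k)
    (h : IsLinCombOn (fun (t : ℕ) n => (jordan t n : ℂ)) N
      (fun n => (coprimePartitions k n : ℂ))) : (k = 2 ∨ k = 3) ∧ k < N := by
  have h4 : k < 4 := not_le.1 fun hk4 => not_isLinCombOn_jordan hk4 N h
  obtain rfl | rfl : k = 2 ∨ k = 3 := by omega
  · exact ⟨Or.inl rfl, two_lt_of_isLinCombOn_jordan h⟩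
  · exact ⟨Or.inr rfl, three_lt_of_isLinCombOn_jordan h⟩

theorem exists_coprimePartitions_eq_mul_jordan {k : ℕ} (hk : k = 2 ∨ k = 3) :
    ∃ q : ℚ, ∀ n, k + 1 ≤ n → (coprimePartitions k n : ℚ) = q * (jordan (k - 1) n : ℚ) := by
  obtain rfl | rfl := hk
  · exact ⟨1 / 2, fun n hn => by rw [coprimePartitions_two_eq hn]; ring⟩
  · exact ⟨1 / 12, fun n hn => by rw [coprimePartitions_three_eq hn]; ring⟩

end SmallCases

/-! ### The main theorem -/

theorem theorem5p1 (k : ℕ) (hk : 2 ≤ k) :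
    -- (i)
    (IsLinCombOn (fun (p : ℕ × {ω : ℂ // ω ∈ rootsUpTo k}) n => jordanRoot p.1 p.2 n) 1
        (fun n => (coprimePartitions k n : ℂ)) ∧
      ∀ n : ℕ, 1 ≤ n → (coprimePartitions k n : ℂ) =
        ∑ ω ∈ rootsUpTo k, ∑ t ∈ Finset.range (poleOrder k ω),
          (rootPoly k ω).coeff t * jordanRoot t ω n) ∧
    -- (ii)
    (IsLinCombOn (fun (p : ℕ × (Σ m : ℕ, Fin m)) n => (jordanMod p.1 p.2.2 p.2.1 n : ℂ)) 1
        (fun n => (coprimePartitions k n : ℂ)) ∧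
      ∀ n : ℕ, 1 ≤ n → (coprimePartitions k n : ℂ) =
        ∑ ω ∈ rootsUpTo k, ∑ t ∈ Finset.range (poleOrder k ω),
          ∑ j ∈ Finset.range (orderOf ω),
            (rootPoly k ω).coeff t * ω ^ j * (jordanMod t j (orderOf ω) n : ℂ)) ∧
    -- (iii)
    (¬ IsLinCombOn (fun (t : ℕ) n => (jordan t n : ℂ)) 1
        (fun n => (coprimePartitions k n : ℂ))) ∧
    -- (iv)
    (∀ N : ℕ, 1 ≤ N →
      IsLinCombOn (fun (t : ℕ) n => (jordan t n : ℂ)) N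
        (fun n => (coprimePartitions k n : ℂ)) →
      (k = 2 ∨ k = 3) ∧
        ∃ q : ℚ, ∀ n : ℕ, N ≤ n → (coprimePartitions k n : ℚ) = q * (jordan (k - 1) n : ℚ)) ∧
    (k = 2 ∨ k = 3 →
      IsLeast {N : ℕ | 1 ≤ N ∧ IsLinCombOn (fun (t : ℕ) n => (jordan t n : ℂ)) N
        (fun n => (coprimePartitions k n : ℂ))} (k + 1)) ∧
    (k = 2 → ∀ n : ℕ, 3 ≤ n → (coprimePartitions k n : ℚ) = (jordan 1 n : ℚ) / 2) ∧
    (k = 3 → ∀ n : ℕ, 4 ≤ n → (coprimePartitions k n : ℚ) = (jordan 2 n : ℚ) / 12) := by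
  refine ⟨⟨isLinCombOn_jordanRoot hk, fun n hn => coprimePartitions_eq_sum_jordanRoot hk hn⟩,
    ⟨isLinCombOn_jordanMod hk, fun n hn => coprimePartitions_eq_sum_jordanMod hk hn⟩,
    fun h => ?_, fun N _ h => ?_, fun hk' => ⟨⟨by omega, ?_⟩, fun N hN => ?_⟩, ?_, ?_⟩
  · have := (eq_and_lt_of_isLinCombOn_jordan hk h).2
    omega
  -- The given combination only restricts `k` and `N`; `q` comes from the closed formulas, valid
  -- since `k + 1 ≤ N`.
  · obtain ⟨hk', hN⟩ := eq_and_lt_of_isLinCombOn_jordan hk h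
    obtain ⟨q, hq⟩ := exists_coprimePartitions_eq_mul_jordan hk'
    exact ⟨hk', q, fun n hn => hq n (by omega)⟩
  · obtain ⟨q, hq⟩ := exists_coprimePartitions_eq_mul_jordan hk'
    exact isLinCombOn_jordan_of_eq hq
  · exact (eq_and_lt_of_isLinCombOn_jordan hk hN.2).2
  · rintro rfl n hn
    exact coprimePartitions_two_eq hn
  · rintro rfl n hn
    exact coprimePartitions_three_eq hn
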